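/- Work over a ground universe $V$ of set theory. Let $A$ and $B\neq\emptyset$ be sets. Let $\Lambda$ be the set of closed $\lambda_c$-terms, modulo $\alpha$-equivalence, built from variables, application, abstraction, $\mathsf{cc}$, continuation constants $k_\pi$ ($\pi\in\Pi$) and special instructions $\xi_a$ ($a\in A$), where $\Pi$ is the set of stacks $t_1\cdot\ldots\cdot t_m\cdot\omega_b$ with $t_i\in\Lambda$, $b\in B$. A *realizability algebra* is a preorder $\succ$ on $\Lambda\times\Pi$ with $ts\star\pi\succ t\star s\cdot\pi$, $\ \lambda u.t\star s\cdot\pi\succ t[u:=s]\star\pi$, $\ \mathsf{cc}\star t\cdot\pi\succ t\star k_\pi\cdot\pi$, $\ k_\sigma\star t\cdot\pi\succ t\star\sigma$, together with a set $\bot\!\!\!\bot\subseteq\Lambda\times\Pi$ (the pole) such that $p\succ q\in\bot\!\!\!\bot$ implies $p\in\bot\!\!\!\bot$. A *realizer* is a closed term without continuation constants. A *pure* term is one with neither continuation constants nor special instructions. *Names* form the least class $N$ containing every set of pairs (name, stack). Closed formulas with parameters in $N$ are built from $a\not\mathrel\varepsilon b$, $a\ne b$, $a\notin b$, $a\subseteq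 b$, $\top$, $\bot$, $\to$, $\forall$ (other connectives are De Morgan abbreviations, $a\simeq b$ is $a\subseteq b\wedge b\subseteq a$, and $a\mathrel\varepsilon b$, $a\in b$ are $a\not\mathrel\varepsilon b\to\bot$, $a\notin b\to\bot$). Falsity values $\|\varphi\|\subseteq\Pi$ are given by: $t\Vdash\varphi$ iff $t\star\pi\in\bot\!\!\!\bot$ for all $\pi\in\|\varphi\|$; $\|\top\|=\emptyset$, $\|\bot\|=\Pi$; $\|a\not\mathrel\varepsilon b\|=\{\pi:(a,\pi)\in b\}$; $\|a\neq b\|$ is $\Pi$ if $a=b$ and $\emptyset$ otherwise; $\|a\notin b\|=\{t\cdot t'\cdot\pi:(c,\pi)\in b,\ t\Vdash a\subseteq c,\ t'\Vdash c\subseteq a\}$; $\|a\subseteq b\|=\{t\cdot\pi:(c,\pi)\in a,\ t\Vdash c\notin b\}$; $\|\varphi\to\psi\|=\{t\cdot\pi:t\Vdash\varphi,\ \pi\in\|\psi\|\}$; $\|\forall x\,\varphi(x)\|=\bigcup_{a\in N}\|\varphi(a)\|$. Write $\mathcal N\Vdash\varphi$ if some realizer $t$ has $t\Vdash\varphi$.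 Let $\kappa=|\Lambda|$ and let $\langle\nu_\alpha:\alpha<\kappa\rangle$ enumerate $\Lambda$. For ordinals put $\gimel_\alpha=\{(\gimel_\beta,\pi):\beta<\alpha,\pi\in\Pi\}$ (the recursive name of $\alpha$), and for $\alpha\le\kappa$ put $\hat\alpha=\{(\hat\beta,\nu_\beta\cdot\pi):\beta<\alpha,\pi\in\Pi\}$; let $\|\forall x^{\hat\alpha}\varphi(x)\|=\bigcup_{\beta<\alpha}\{\nu_\beta\cdot\pi:\pi\in\|\varphi(\hat\beta)\|\}$ (quantification over $x\mathrel\varepsilon\hat\alpha$). Let $\mathsf{succ}:\kappa\to\kappa$, $\alpha\mapsto\alpha+1$. Its ordered lift is the name $\widehat{\mathsf{succ}}=\{(\mathtt{op}(\hat\alpha,\widehat{\alpha+1}),\nu_\alpha\cdot\pi):\alpha<\kappa,\pi\in\Pi\}$, where $\mathtt{op}(a,b)=\mathtt{up}(\mathtt{up}(\mathtt{sng}(a),\emptyset),\mathtt{sng}(\mathtt{sng}(b)))$, $\mathtt{sng}(a)=\{a\}\times\Pi$, $\mathtt{up}(a,b)=\{(a,(\lambda u\lambda v.v)\cdot\pi):\pi\in\Pi\}\cup\{(b,(\lambda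 u\lambda v.uv)\cdot\pi):\pi\in\Pi\}$; used as a function symbol, $\|\forall x^{\hat\kappa}\varphi(x,\widehat{\mathsf{succ}}(x))\|=\bigcup_{\alpha<\kappa}\{\nu_\alpha\cdot\pi:\pi\in\|\varphi(\hat\alpha,\widehat{\alpha+1})\|\}$. The formula $z\simeq x+1$ is $\forall w\,(w\in z\leftrightarrow w\in x\vee w\simeq x)$. Let $w_0=\theta\theta$ with $\theta=\lambda u\lambda v.\,v(uu)(uu)$. **Lemma.** There are pure closed terms $t$, $s$ and $r_n$ ($n\in\omega$) such that for every realizability algebra (whatever $A$, $B$, $\succ$ and the pole are) and every enumeration $\nu$: 1. $w_0\Vdash\forall x\,(x\subseteq x)$, and $\ \lambda v\lambda w.\,w(\lambda u.\,u\,w_0\,w_0)\Vdash\forall x^{\hat\kappa}\,\forall y\,\big((y\subseteq x\to\bot)\to y\not\mathrel\varepsilon\widehat{\mathsf{succ}}(x)\big)$. 2. $t\Vdash\forall x^{\hat\kappa}\,\big(\widehat{\mathsf{succ}}(x)\simeq x+1\big)$; and, for $\widehat{\mathsf{succ}}$ as a name, $s\Vdash\forall x^{\hat\kappa}\,\forall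 y\,\big(\mathtt{op}(x,y)\mathrel\varepsilon\widehat{\mathsf{succ}}\to y\simeq x+1\big)$. 3. For all $\alpha<\kappa$, $\ t\,\nu_\alpha\Vdash\widehat{\alpha+1}\simeq\hat\alpha+1$; hence $\mathcal N\Vdash\widehat{\alpha+1}\simeq\hat\alpha+1$ whenever $\nu_\alpha$ is a realizer. 4. For all $n\in\omega$, $\ r_n\,\nu_0\cdots\nu_{n-1}\Vdash\gimel_n\simeq\hat n$; hence $\mathcal N\Vdash\gimel_n\simeq\hat n$ whenever $\nu_0,\dots,\nu_{n-1}$ are realizers (for example Church numerals). -/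

import Mathlib

universe u

namespace Realizability

/-! ## Terms, stacks, evaluation -/

mutual
/-- `Term A B n`: the `λ_c`-terms modulo `α`-equivalence with special instructions indexed by `A`,
stack bottoms indexed by `B`, and free variables among `n` variables (well-scoped de Bruijn
indices; the variable `0` is the innermost one). The closed terms are `Term A B 0`. -/
inductive Term (A B : Type u) : ℕ → Type u
  | var {n : ℕ} : Fin n → Term A B n
  | app {n : ℕ} : Term A B n → Term A B n → Term A B n
  | lam {n : ℕ} : Term A B (n + 1) → Term A B n
  | cc {n : ℕ} : Term A B n
  | cont {n : ℕ} : Stack A B → Term A B n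
  | instr {n : ℕ} : A → Term A B n
/-- Stacks: finite sequences of closed terms, ending with a stack bottom. -/
inductive Stack (A B : Type u) : Type u
  | bottom : B → Stack A B
  | push : Term A B 0 → Stack A B → Stack A B
end

/-- The set `Λ` of closed terms. -/
abbrev Closed (A B : Type u) : Type u := Term A B 0

namespace Term

variable {A B : Type u}

/-- Renaming of free variables. -/
def rename : {n m : ℕ} → (Fin n → Fin m) → Term A B n → Term A B m
  | _, _, ρ, var i => var (ρ i)
  | _, _, ρ, app t s => app (rename ρ t) (rename ρ s)
  | _, _, ρ, lam t => lam (rename (Fin.cases 0 fun i => (ρ i).succ) t)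
  | _, _, _, cc => cc
  | _, _, _, cont π => cont π
  | _, _, _, instr a => instr a

/-- Simultaneous capture-avoiding substitution. -/
def subst : {n m : ℕ} → (Fin n → Term A B m) → Term A B n → Term A B m
  | _, _, σ, var i => σ i
  | _, _, σ, app t s => app (subst σ t) (subst σ s)
  | _, _, σ, lam t => lam (subst (Fin.cases (var 0) fun i => (σ i).rename Fin.succ) t)
  | _, _, _, cc => cc
  | _, _, _, cont π => cont π
  | _, _, _, instr a => instr a

/-- `t[u := s]` for a term `t` whose only free variable is `u`, and a closed term `s`. -/
def inst (t : Term A B 1) (s : Closed A B) : Closed A B := t.subst fun _ => s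

/-- A (closed) term is a realizer if no continuation constant occurs in it. -/
def IsRealizer : {n : ℕ} → Term A B n → Prop
  | _, var _ => True
  | _, app t s => t.IsRealizer ∧ s.IsRealizer
  | _, lam t => t.IsRealizer
  | _, cc => True
  | _, cont _ => False
  | _, instr _ => True

end Term

/-- Terms of the pure `λ_c`-calculus: no special instruction and no continuation constant.
They are interpreted in every realizability algebra through `PureTerm.toTerm`. -/
inductive PureTerm : ℕ → Type
  | var {n : ℕ} : Fin n → PureTerm n
  | app {n : ℕ} : PureTerm n → PureTerm n → PureTerm n
  | lam {n : ℕ} : PureTerm (n + 1) → PureTerm n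
  | cc {n : ℕ} : PureTerm n

namespace PureTerm

def toTerm (A B : Type u) : {n : ℕ} → PureTerm n → Term A B n
  | _, var i => .var i
  | _, app t s => .app (t.toTerm A B) (s.toTerm A B)
  | _, lam t => .lam (t.toTerm A B)
  | _, cc => .cc

theorem isRealizer_toTerm (A B : Type u) {n : ℕ} (t : PureTerm n) : (t.toTerm A B).IsRealizer := by
  induction t with
  | var i => exact trivial
  | app t s iht ihs => exact ⟨iht, ihs⟩
  | lam t ih => exact ih
  | cc => exact trivial

/-- `θ = λu. λv. v (u u) (u u)`. -/
def theta {n : ℕ} : PureTerm n :=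
  lam (lam (app (app (var 0) (app (var 1) (var 1))) (app (var 1) (var 1))))

/-- `w₀ = θ θ`, the fixed realizer of `∀ x (x ⊆ x)`. -/
def w₀ {n : ℕ} : PureTerm n := app theta theta

/-- `λv. λw. w (λu. u w₀ w₀)`. -/
def succRealizer : PureTerm 0 :=
  lam (lam (app (var 0) (lam (app (app (var 0) w₀) w₀))))

/-- The Church numeral `λu. λv. v`. -/
def churchZero : PureTerm 0 := lam (lam (var 0))

/-- The Church numeral `λu. λv. u v`. -/
def churchOne : PureTerm 0 := lam (lam (app (var 1) (var 0)))

end PureTerm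

/-- The basic evaluation steps on processes; `EvalStep p q` is one step from `p` to `q`. -/
inductive EvalStep {A B : Type u} :
    Closed A B × Stack A B → Closed A B × Stack A B → Prop
  | push (t s : Closed A B) (π : Stack A B) : EvalStep (.app t s, π) (t, .push s π)
  | grab (t : Term A B 1) (s : Closed A B) (π : Stack A B) :
      EvalStep (.lam t, .push s π) (t.inst s, π)
  | save (t : Closed A B) (π : Stack A B) : EvalStep (.cc, .push t π) (t, .push (.cont π) π)
  | restore (t : Closed A B) (σ π : Stack A B) : EvalStep (.cont σ, .push t π) (t, σ)

/-- A realizability algebra with instructions `A` and stack bottoms `B`: a preorder on processes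
(`red p q` is `p ≻ q`) that extends the evaluation preorder, and a pole closed under
anti-evaluation. -/
structure RealizabilityAlgebra (A B : Type u) where
  red : Closed A B × Stack A B → Closed A B × Stack A B → Prop
  red_refl : ∀ p, red p p
  red_trans : ∀ p q r, red p q → red q r → red p r
  red_of_evalStep : ∀ p q, EvalStep p q → red p q
  pole : Set (Closed A B × Stack A B)
  pole_closed : ∀ p q, red p q → q ∈ pole → p ∈ pole

/-! ## Names

The names over a set `P` (of stacks) form the cumulative hierarchy of sets of pairs (name, stack):
a name is exactly a set-sized (`u`-small) set of pairs (name, element of `P`). It is obtained here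
as the quotient of well-founded trees by extensional equality; `Name.ext` and `Name.mem_ofSet`
say that it is the hierarchy described. -/

/-- Well-founded trees representing names. -/
inductive PreName (P : Type u) : Type (u + 1)
  | mk (ι : Type u) (f : ι → PreName P) (s : ι → P) : PreName P

namespace PreName

variable {P : Type u}

/-- Extensional equality of trees. -/
def Equiv : PreName P → PreName P → Prop
  | mk ι f s, mk κ g t =>
    (∀ i : ι, ∃ j : κ, Equiv (f i) (g j) ∧ s i = t j) ∧
    (∀ j : κ, ∃ i : ι, Equiv (f i) (g j) ∧ s i = t j)

theorem Equiv.refl (x : PreName P) : Equiv x x := by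
  induction x with
  | mk ι f s ih => exact ⟨fun i => ⟨i, ih i, rfl⟩, fun i => ⟨i, ih i, rfl⟩⟩

theorem Equiv.symm {x y : PreName P} (h : Equiv x y) : Equiv y x := by
  induction x generalizing y with
  | mk ι f s ih =>
    cases y with
    | mk κ g t =>
      refine ⟨fun j => ?_, fun i => ?_⟩
      · obtain ⟨i, hi, e⟩ := h.2 j
        exact ⟨i, ih i hi, e.symm⟩
      · obtain ⟨j, hj, e⟩ := h.1 i
        exact ⟨j, ih i hj, e.symm⟩

theorem Equiv.trans {x y z : PreName P} (h : Equiv x y) (h' : Equiv y z) : Equiv x z := by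
  induction x generalizing y z with
  | mk ι f s ih =>
    cases y with
    | mk κ g t =>
      cases z with
      | mk μ k r =>
        refine ⟨fun i => ?_, fun l => ?_⟩
        · obtain ⟨j, hj, e⟩ := h.1 i
          obtain ⟨l, hl, e'⟩ := h'.1 j
          exact ⟨l, ih i hj hl, e.trans e'⟩
        · obtain ⟨j, hj, e⟩ := h'.2 l
          obtain ⟨i, hi, e'⟩ := h.2 j
          exact ⟨i, ih i hi hj, e'.trans e⟩

instance setoid (P : Type u) : Setoid (PreName P) :=
  ⟨Equiv, Equiv.refl, Equiv.symm, Equiv.trans⟩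

end PreName

/-- The class of names over `P`. -/
def Name (P : Type u) : Type (u + 1) := Quotient (PreName.setoid P)

namespace Name

variable {P : Type u}

/-- The elements of a tree, as pairs (name, element of `P`). -/
def preElems : PreName P → Set (Name P × P)
  | .mk ι f s => Set.range fun i : ι => ((Quotient.mk _ (f i) : Name P), s i)

theorem preElems_eq_iff (x y : PreName P) : preElems x = preElems y ↔ PreName.Equiv x y := by
  cases x with
  | mk ι f s =>
    cases y with
    | mk κ g t =>
      constructor
      · intro h
        refine ⟨fun i => ?_, fun j => ?_⟩
        · obtain ⟨j, hj⟩ := h.subset ⟨i, rfl⟩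
          obtain ⟨h1, h2⟩ := Prod.mk.inj hj
          exact ⟨j, (Quotient.exact h1).symm, h2.symm⟩
        · obtain ⟨i, hi⟩ := h.superset ⟨j, rfl⟩
          obtain ⟨h1, h2⟩ := Prod.mk.inj hi
          exact ⟨i, Quotient.exact h1, h2⟩
      · intro h
        apply Set.Subset.antisymm
        · rintro _ ⟨i, rfl⟩
          obtain ⟨j, hj, e⟩ := h.1 i
          exact ⟨j, Prod.ext (Quotient.sound hj.symm) e.symm⟩
        · rintro _ ⟨j, rfl⟩
          obtain ⟨i, hi, e⟩ := h.2 j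
          exact ⟨i, Prod.ext (Quotient.sound hi) e⟩

/-- A name as a set of pairs. -/
def elems (a : Name P) : Set (Name P × P) :=
  Quotient.lift preElems (fun x y h => (preElems_eq_iff x y).2 h) a

theorem ext {a b : Name P} (h : a.elems = b.elems) : a = b := by
  induction a using Quotient.inductionOn with
  | _ x =>
    induction b using Quotient.inductionOn with
    | _ y => exact Quotient.sound ((preElems_eq_iff x y).1 h)

/-- Every small set of pairs is a name. -/
noncomputable def ofSet (S : Set (Name P × P)) [Small.{u} S] : Name P :=
  Quotient.mk _ (PreName.mk (Shrink.{u} S)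
    (fun i => ((equivShrink S).symm i).1.1.out) (fun i => ((equivShrink S).symm i).1.2))

theorem elems_ofSet (S : Set (Name P × P)) [Small.{u} S] : (ofSet S).elems = S := by
  apply Set.Subset.antisymm
  · rintro _ ⟨i, rfl⟩
    have : (Quotient.mk _ (((equivShrink S).symm i).1.1.out) : Name P) =
        ((equivShrink S).symm i).1.1 := Quotient.out_eq _
    simp only [this]
    exact ((equivShrink S).symm i).2
  · intro p hp
    refine ⟨equivShrink S ⟨p, hp⟩, ?_⟩
    simp only [Equiv.symm_apply_apply]
    exact Prod.ext (Quotient.out_eq _) rfl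

theorem mem_ofSet {S : Set (Name P × P)} [Small.{u} S] {p : Name P × P} :
    p ∈ (ofSet S).elems ↔ p ∈ S := by
  rw [elems_ofSet]

instance small_elems (a : Name P) : Small.{u} a.elems := by
  induction a using Quotient.inductionOn with
  | _ x =>
    cases x with
    | mk ι f s => exact small_range _

/-- `InDom c a`: `c ∈ dom(a)`. -/
def InDom (c a : Name P) : Prop := ∃ π, (c, π) ∈ a.elems

theorem wellFounded_inDom : WellFounded (InDom (P := P)) := by
  refine ⟨fun a => ?_⟩
  induction a using Quotient.inductionOn with
  | _ x =>
    induction x with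
    | mk ι f s ih =>
      refine ⟨_, ?_⟩
      rintro c ⟨π, i, hi⟩
      obtain rfl : (Quotient.mk _ (f i) : Name P) = c := congrArg Prod.fst hi
      exact ih i

/-- The empty name. -/
noncomputable def empty (P : Type u) : Name P := ofSet ∅

end Name

/-! ## Formulas and their truth and falsity values -/

/-- Closed formulas, with parameters in the names, of the language with primitive relations
`∉_ε`, `≠`, `∉`, `⊆` and primitive constructions `⊤`, `⊥`, `→`, `∀`. The quantifier `ball ν α φ` is
the quantifier `∀ x^α̂` bounded by the hat name of `α`; see `Formula.hatAll`. -/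
inductive Formula (A B : Type u) : Type (u + 1)
  | top : Formula A B
  | bot : Formula A B
  | nmemEps (a b : Name (Stack A B)) : Formula A B
  | ne (a b : Name (Stack A B)) : Formula A B
  | nmem (a b : Name (Stack A B)) : Formula A B
  | sub (a b : Name (Stack A B)) : Formula A B
  | imp (φ ψ : Formula A B) : Formula A B
  | all (φ : Name (Stack A B) → Formula A B) : Formula A B
  | ball (ν : Ordinal.{u} → Closed A B) (α : Ordinal.{u}) (φ : Ordinal.{u} → Formula A B) :
      Formula A B

namespace RealizabilityAlgebra

variable {A B : Type u} (𝒜 : RealizabilityAlgebra A B)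

/-- The truth value attached to a falsity value. -/
def truthOf (X : Set (Stack A B)) : Set (Closed A B) := {t | ∀ π ∈ X, (t, π) ∈ 𝒜.pole}

/-- The two falsity values below are defined by recursion on the unordered pair of names. -/
instance wfSym2 {P : Type u} : WellFoundedRelation (Sym2 (Name P)) :=
  ⟨Sym2.GameAdd Name.InDom, Name.wellFounded_inDom.sym2_gameAdd⟩

mutual
/-- The falsity value of `a ∉ b`. -/
def nmemFalsity (a b : Name (Stack A B)) : Set (Stack A B) :=
  {ρ | ∃ (c : Name (Stack A B)) (π : Stack A B) (_ : (c, π) ∈ b.elems) (t t' : Closed A B),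
    ρ = .push t (.push t' π) ∧
      t ∈ 𝒜.truthOf (subFalsity a c) ∧ t' ∈ 𝒜.truthOf (subFalsity c a)}
termination_by s(a, b)
decreasing_by
  · exact Sym2.GameAdd.snd ⟨_, ‹_›⟩
  · exact Sym2.GameAdd.fst_snd ⟨_, ‹_›⟩
/-- The falsity value of `a ⊆ b`. -/
def subFalsity (a b : Name (Stack A B)) : Set (Stack A B) :=
  {ρ | ∃ (c : Name (Stack A B)) (π : Stack A B) (_ : (c, π) ∈ a.elems) (t : Closed A B),
    ρ = .push t π ∧ t ∈ 𝒜.truthOf (nmemFalsity c b)}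
termination_by s(a, b)
decreasing_by
  · exact Sym2.GameAdd.fst ⟨_, ‹_›⟩
end

theorem mem_nmemFalsity (a b : Name (Stack A B)) (ρ : Stack A B) :
    ρ ∈ 𝒜.nmemFalsity a b ↔ ∃ c π t t', (c, π) ∈ b.elems ∧ ρ = .push t (.push t' π) ∧
      t ∈ 𝒜.truthOf (𝒜.subFalsity a c) ∧ t' ∈ 𝒜.truthOf (𝒜.subFalsity c a) := by
  rw [nmemFalsity]
  constructor
  · rintro ⟨c, π, h, t, t', h'⟩
    exact ⟨c, π, t, t', h, h'⟩
  · rintro ⟨c, π, t, t', h, h'⟩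
    exact ⟨c, π, h, t, t', h'⟩

theorem mem_subFalsity (a b : Name (Stack A B)) (ρ : Stack A B) :
    ρ ∈ 𝒜.subFalsity a b ↔ ∃ c π t, (c, π) ∈ a.elems ∧ ρ = .push t π ∧
      t ∈ 𝒜.truthOf (𝒜.nmemFalsity c b) := by
  rw [subFalsity]
  constructor
  · rintro ⟨c, π, h, t, h'⟩
    exact ⟨c, π, t, h, h'⟩
  · rintro ⟨c, π, t, h, h'⟩
    exact ⟨c, π, h, t, h'⟩

/-- The falsity value of a closed formula. -/
def falsity : Formula A B → Set (Stack A B)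
  | .top => ∅
  | .bot => Set.univ
  | .nmemEps a b => {π | (a, π) ∈ b.elems}
  | .ne a b => {_π | a = b}
  | .nmem a b => 𝒜.nmemFalsity a b
  | .sub a b => 𝒜.subFalsity a b
  | .imp φ ψ => {ρ | ∃ t π, ρ = .push t π ∧ t ∈ 𝒜.truthOf (falsity φ) ∧ π ∈ falsity ψ}
  | .all φ => {π | ∃ a, π ∈ falsity (φ a)}
  | .ball ν α φ => {ρ | ∃ β < α, ∃ π, ρ = .push (ν β) π ∧ π ∈ falsity (φ β)}

/-- `t ⊩ φ`. -/
def Realizes (t : Closed A B) (φ : Formula A B) : Prop := t ∈ 𝒜.truthOf (𝒜.falsity φ)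

/-- `𝒩 ⊩ φ`: some realizer realizes `φ`, i.e. `φ` is in the realizability theory. -/
def Models (φ : Formula A B) : Prop := ∃ t : Closed A B, t.IsRealizer ∧ 𝒜.Realizes t φ

end RealizabilityAlgebra

/-! ## Names for ordinals, and ordered lifts -/

/-- The cardinal `κ = |Λ|`, as an initial ordinal. -/
noncomputable def kappa (A B : Type u) : Ordinal.{u} := (Cardinal.mk (Closed A B)).ord

/-- The hat name `α̂ = {(β̂, ν_β . π) | β < α, π ∈ Π}`, for an enumeration `ν` of the closed terms in
order type `κ`; it is meant for `α ≤ κ`. -/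
noncomputable def hat {A B : Type u} (ν : Ordinal.{u} → Closed A B) (α : Ordinal.{u}) :
    Name (Stack A B) :=
  Name.ofSet (Set.range fun p : Set.Iio α × Stack A B => (hat ν p.1.1, Stack.push (ν p.1.1) p.2))
termination_by α
decreasing_by exact p.1.2

/-- The recursive (reish) name of an ordinal `α`: the set of the pairs
(name of `β`, `π`) with `β < α` and `π ∈ Π`. -/
noncomputable def reish (A B : Type u) (α : Ordinal.{u}) : Name (Stack A B) :=
  Name.ofSet (Set.range fun p : Set.Iio α × Stack A B => (reish A B p.1.1, p.2))
termination_by α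
decreasing_by exact p.1.2

theorem mem_hat {A B : Type u} (ν : Ordinal.{u} → Closed A B) (α : Ordinal.{u})
    (p : Name (Stack A B) × Stack A B) :
    p ∈ (hat ν α).elems ↔ ∃ β < α, ∃ π, p = (hat ν β, .push (ν β) π) := by
  rw [hat, Name.mem_ofSet]
  constructor
  · rintro ⟨⟨⟨β, hβ⟩, π⟩, rfl⟩
    exact ⟨β, hβ, π, rfl⟩
  · rintro ⟨β, hβ, π, rfl⟩
    exact ⟨⟨⟨β, hβ⟩, π⟩, rfl⟩

theorem mem_reish {A B : Type u} (α : Ordinal.{u}) (p : Name (Stack A B) × Stack A B) :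
    p ∈ (reish A B α).elems ↔ ∃ β < α, ∃ π, p = (reish A B β, π) := by
  rw [reish, Name.mem_ofSet]
  constructor
  · rintro ⟨⟨⟨β, hβ⟩, π⟩, rfl⟩
    exact ⟨β, hβ, π, rfl⟩
  · rintro ⟨β, hβ, π, rfl⟩
    exact ⟨⟨⟨β, hβ⟩, π⟩, rfl⟩

section Pairing

variable {A B : Type u}

/-- `sng(a) = {a} × Π`. -/
noncomputable def sng (a : Name (Stack A B)) : Name (Stack A B) :=
  Name.ofSet (Set.range fun π : Stack A B => (a, π))

/-- `up(a, b) = {(a, 0 . π) | π ∈ Π} ∪ {(b, 1 . π) | π ∈ Π}` with the Church numerals 0 and 1. -/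
noncomputable def up (a b : Name (Stack A B)) : Name (Stack A B) :=
  Name.ofSet
    ((Set.range fun π : Stack A B => (a, Stack.push (PureTerm.churchZero.toTerm A B) π)) ∪
      (Set.range fun π : Stack A B => (b, Stack.push (PureTerm.churchOne.toTerm A B) π)))

/-- `op(a, b) = up(up(sng(a), 0), sng(sng(b)))`, where `0` is the empty name. -/
noncomputable def op (a b : Name (Stack A B)) : Name (Stack A B) :=
  up (up (sng a) (Name.empty _)) (sng (sng b))

end Pairing

/-- The ordered lift of `f : κ → κ`: the name
`{(op(α̂, hat (f α)), ν_α . π) | α < κ, π ∈ Π}`. -/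
noncomputable def orderedLift {A B : Type u} (ν : Ordinal.{u} → Closed A B)
    (f : Ordinal.{u} → Ordinal.{u}) : Name (Stack A B) :=
  Name.ofSet (Set.range fun p : Set.Iio (kappa A B) × Stack A B =>
    (op (hat ν p.1.1) (hat ν (f p.1.1)), Stack.push (ν p.1.1) p.2))

/-! ## Abbreviations in the language -/

namespace Formula

variable {A B : Type u}

/-- `¬ φ` -/
def neg (φ : Formula A B) : Formula A B := imp φ bot

/-- `φ ∧ ψ`, i.e. `(φ → (ψ → ⊥)) → ⊥` -/
def and (φ ψ : Formula A B) : Formula A B := imp (imp φ (imp ψ bot)) bot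

/-- `φ ∨ ψ`, i.e. `(φ → ⊥) → ((ψ → ⊥) → ⊥)` -/
def or (φ ψ : Formula A B) : Formula A B := imp (imp φ bot) (imp (imp ψ bot) bot)

/-- `φ ↔ ψ` -/
def iff (φ ψ : Formula A B) : Formula A B := and (imp φ ψ) (imp ψ φ)

/-- `a ∈ b` -/
def mem (a b : Name (Stack A B)) : Formula A B := neg (nmem a b)

/-- `a ε b` -/
def memEps (a b : Name (Stack A B)) : Formula A B := neg (nmemEps a b)

/-- `a ≃ b` -/
def simeq (a b : Name (Stack A B)) : Formula A B := and (sub a b) (sub b a)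

/-- `z ≃ x + 1`, i.e. `z ≃ x ∪ {x}`, i.e. `∀ w (w ∈ z ↔ w ∈ x ∨ w ≃ x)`. -/
def isSucc (z x : Name (Stack A B)) : Formula A B :=
  all fun w => iff (mem w z) (or (mem w x) (simeq w x))

/-- `∀ x^α̂ φ(x)`, with falsity value `⋃_{β < α} {ν_β . π | π ∈ ‖φ(β̂)‖}`. -/
noncomputable def hatAll (ν : Ordinal.{u} → Closed A B) (α : Ordinal.{u})
    (φ : Name (Stack A B) → Formula A B) : Formula A B :=
  ball ν α fun β => φ (hat ν β)

/-- `∀ x^κ̂ φ(x, f̂(x))`, with falsity value `⋃_{β < κ} {ν_β . π | π ∈ ‖φ(β̂, hat (f β))‖}`. -/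
noncomputable def hatAllLift (ν : Ordinal.{u} → Closed A B) (f : Ordinal.{u} → Ordinal.{u})
    (φ : Name (Stack A B) → Name (Stack A B) → Formula A B) : Formula A B :=
  ball ν (kappa A B) fun β => φ (hat ν β) (hat ν (f β))

end Formula

/-- `t ν_0 ν_1 ⋯ ν_{n-1}` -/
def appInitial {A B : Type u} (ν : Ordinal.{u} → Closed A B) (t : Closed A B) : ℕ → Closed A B
  | 0 => t
  | n + 1 => .app (appInitial ν t n) (ν n)

end Realizability

namespace Realizability

/-! ## Substitution -/

namespace Term

variable {A B : Type u}

-- Each claim is checked by running the proposed term against an arbitrary stack of the falsity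
-- value, using closure of the pole under anti-evaluation. Hat names, and likewise recursive names,
-- increase with the ordinal as sets of pairs, so a realizer of an inclusion or non-membership can
-- be reused unchanged when the ordinal moves in the right direction (`hat_elems_mono`,
-- `nmem_of_subset`).
--
-- The engine is `comparison_sub`: for hereditarily transitive names, one fixed point turns a
-- realizer of a ∉ b into one of b ⊆ a. This is linearity of the ordinals, obtained without deciding
-- which ordinal is smaller. For the successor, if w ≃ γ̂ with γ ≤ β and w ∉ β̂, then γ̂ ∉ β̂, so β̂
-- ⊆ γ̂ by comparison, and w ≃ β̂. The converse must exhibit β̂ as an element of the successor name,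
-- and this is where the code ν_β is needed. For the lift as a name, injectivity of `op` identifies
-- the components, and the code is read off the lift while `cc` keeps the target stack.
--
-- A recursive name accepts every stack at each of its elements, so a fixed point without codes
-- realizes the inclusion of the hat name in the recursive name, for all ordinals at once. The
-- reverse inclusion is built up from 0, the step from m to m + 1 using the code ν_m.

theorem rename_rename : {n m k : ℕ} → (ρ : Fin n → Fin m) → (τ : Fin m → Fin k) →
    (t : Term A B n) → (t.rename ρ).rename τ = t.rename (fun i => τ (ρ i))
  | _, _, _, ρ, τ, var i => by simp [rename]
  | _, _, _, ρ, τ, app t s => by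
      simp only [rename, rename_rename ρ τ t, rename_rename ρ τ s]
  | _, _, _, ρ, τ, lam t => by
      simp only [rename]
      rw [rename_rename _ _ t]
      congr 2
      funext i
      cases i using Fin.cases <;> rfl
  | _, _, _, _, _, cc => by simp [rename]
  | _, _, _, _, _, cont π => by simp [rename]
  | _, _, _, _, _, instr a => by simp [rename]

theorem subst_rename : {n m k : ℕ} → (ρ : Fin n → Fin m) → (σ : Fin m → Term A B k) →
    (t : Term A B n) → (t.rename ρ).subst σ = t.subst (fun i => σ (ρ i))
  | _, _, _, ρ, σ, var i => by simp [rename, subst]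
  | _, _, _, ρ, σ, app t s => by
      simp only [rename, subst, subst_rename ρ σ t, subst_rename ρ σ s]
  | _, _, _, ρ, σ, lam t => by
      simp only [rename, subst]
      rw [subst_rename _ _ t]
      congr 2
      funext i
      cases i using Fin.cases <;> rfl
  | _, _, _, _, _, cc => by simp [rename, subst]
  | _, _, _, _, _, cont π => by simp [rename, subst]
  | _, _, _, _, _, instr a => by simp [rename, subst]

theorem rename_subst : {n m k : ℕ} → (σ : Fin n → Term A B m) → (ρ : Fin m → Fin k) →
    (t : Term A B n) → (t.subst σ).rename ρ = t.subst (fun i => (σ i).rename ρ)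
  | _, _, _, σ, ρ, var i => by simp [subst]
  | _, _, _, σ, ρ, app t s => by
      simp only [rename, subst, rename_subst σ ρ t, rename_subst σ ρ s]
  | _, _, _, σ, ρ, lam t => by
      simp only [rename, subst]
      rw [rename_subst _ _ t]
      congr 2
      funext i
      cases i using Fin.cases
      · rfl
      · simp [rename_rename]
  | _, _, _, _, _, cc => by simp [rename, subst]
  | _, _, _, _, _, cont π => by simp [rename, subst]
  | _, _, _, _, _, instr a => by simp [rename, subst]

theorem subst_subst : {n m k : ℕ} → (σ : Fin n → Term A B m) → (τ : Fin m → Term A B k) →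
    (t : Term A B n) → (t.subst σ).subst τ = t.subst (fun i => (σ i).subst τ)
  | _, _, _, σ, τ, var i => by simp [subst]
  | _, _, _, σ, τ, app t s => by
      simp only [subst, subst_subst σ τ t, subst_subst σ τ s]
  | _, _, _, σ, τ, lam t => by
      simp only [subst]
      rw [subst_subst _ _ t]
      congr 2
      funext i
      cases i using Fin.cases
      · rfl
      · simp [subst_rename, rename_subst]
  | _, _, _, _, _, cc => by simp [subst]
  | _, _, _, _, _, cont π => by simp [subst]
  | _, _, _, _, _, instr a => by simp [subst]

theorem subst_var : {n : ℕ} → (t : Term A B n) → t.subst var = t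
  | _, var i => by simp [subst]
  | _, app t s => by simp only [subst, subst_var t, subst_var s]
  | _, lam t => by
      simp only [subst]
      congr 1
      convert subst_var t using 2
      funext i
      cases i using Fin.cases <;> rfl
  | _, cc => by simp [subst]
  | _, cont π => by simp [subst]
  | _, instr a => by simp [subst]

theorem subst_closed (σ : Fin 0 → Closed A B) (t : Closed A B) : t.subst σ = t := by
  rw [Subsingleton.elim σ var, subst_var]

/-- Since the values of σ are closed, weakening them under a binder and then instantiating leaves
them unchanged. A β-step on a closed instance of an open term therefore just extends the
environment, which lets the realizers be evaluated symbolically. -/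
theorem inst_subst_lift {n : ℕ} (σ : Fin n → Closed A B) (t : Term A B (n + 1))
    (s : Closed A B) :
    (t.subst (Fin.cases (var 0) fun i => (σ i).rename Fin.succ)).inst s =
      t.subst (Fin.cons s σ) := by
  rw [inst, subst_subst]
  congr 1
  funext i
  cases i using Fin.cases with
  | zero => simp [subst]
  | succ i => simp only [Fin.cases_succ, Fin.cons_succ, subst_rename, subst_closed]

end Term

namespace PureTerm

variable {A B : Type u}

/-- The closed term obtained from a pure term by substituting closed terms for its variables. -/
def close {n : ℕ} (t : PureTerm n) (σ : Fin n → Closed A B) : Closed A B :=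
  (t.toTerm A B).subst σ

theorem toTerm_eq_close (t : PureTerm 0) (σ : Fin 0 → Closed A B) : t.toTerm A B = t.close σ :=
  (Term.subst_closed σ _).symm

end PureTerm

namespace RealizabilityAlgebra

variable {A B : Type u} (𝒜 : RealizabilityAlgebra A B)

/-! ## Evaluation of pure terms under an environment -/

section Evaluation

open PureTerm

variable {𝒜} {n : ℕ} {σ : Fin n → Closed A B} {π : Stack A B}

theorem pole_of_evalStep {p q : Closed A B × Stack A B} (h : EvalStep p q) (hq : q ∈ 𝒜.pole) :
    p ∈ 𝒜.pole :=
  𝒜.pole_closed p q (𝒜.red_of_evalStep p q h) hq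

theorem pole_app {t s : Closed A B} (h : (t, Stack.push s π) ∈ 𝒜.pole) :
    (Term.app t s, π) ∈ 𝒜.pole :=
  pole_of_evalStep (.push t s π) h

theorem pole_close_app {t s : PureTerm n} (h : (t.close σ, Stack.push (s.close σ) π) ∈ 𝒜.pole) :
    ((t.app s).close σ, π) ∈ 𝒜.pole :=
  pole_app h

theorem pole_close_lam {t : PureTerm (n + 1)} {s : Closed A B}
    (h : (t.close (Fin.cons s σ), π) ∈ 𝒜.pole) : (t.lam.close σ, Stack.push s π) ∈ 𝒜.pole := by
  refine pole_of_evalStep (.grab _ s π) ?_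
  rw [Term.inst_subst_lift]
  exact h

theorem pole_close_var {i : Fin n} (h : (σ i, π) ∈ 𝒜.pole) :
    ((PureTerm.var i).close σ, π) ∈ 𝒜.pole := h

theorem pole_close_cc {t : Closed A B} (h : (t, Stack.push (.cont π) π) ∈ 𝒜.pole) :
    ((PureTerm.cc : PureTerm n).close σ, Stack.push t π) ∈ 𝒜.pole :=
  pole_of_evalStep (.save t π) h

theorem pole_cont {t : Closed A B} {ρ : Stack A B} (h : (t, ρ) ∈ 𝒜.pole) :
    (Term.cont ρ, Stack.push t π) ∈ 𝒜.pole :=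
  pole_of_evalStep (.restore t ρ π) h

end Evaluation

/-! ## Falsity values of the membership and inclusion relations -/

section Relations

variable {𝒜}

variable {a b c : Name (Stack A B)} {t : Closed A B}

theorem sub_intro (h : ∀ c π s, (c, π) ∈ a.elems → s ∈ 𝒜.truthOf (𝒜.nmemFalsity c b) →
    (t, Stack.push s π) ∈ 𝒜.pole) : t ∈ 𝒜.truthOf (𝒜.subFalsity a b) := by
  intro ρ hρ
  obtain ⟨c, π, s, hc, rfl, hs⟩ := (𝒜.mem_subFalsity a b ρ).1 hρ
  exact h c π s hc hs

theorem sub_elim {π : Stack A B} {s : Closed A B} (ht : t ∈ 𝒜.truthOf (𝒜.subFalsity a b))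
    (hc : (c, π) ∈ a.elems) (hs : s ∈ 𝒜.truthOf (𝒜.nmemFalsity c b)) :
    (t, Stack.push s π) ∈ 𝒜.pole :=
  ht _ ((𝒜.mem_subFalsity a b _).2 ⟨c, π, s, hc, rfl, hs⟩)

theorem nmem_intro (h : ∀ c π s s', (c, π) ∈ b.elems → s ∈ 𝒜.truthOf (𝒜.subFalsity a c) →
    s' ∈ 𝒜.truthOf (𝒜.subFalsity c a) → (t, Stack.push s (.push s' π)) ∈ 𝒜.pole) :
    t ∈ 𝒜.truthOf (𝒜.nmemFalsity a b) := by
  intro ρ hρ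
  obtain ⟨c, π, s, s', hc, rfl, hs, hs'⟩ := (𝒜.mem_nmemFalsity a b ρ).1 hρ
  exact h c π s s' hc hs hs'

theorem nmem_elim {π : Stack A B} {s s' : Closed A B}
    (ht : t ∈ 𝒜.truthOf (𝒜.nmemFalsity a b)) (hc : (c, π) ∈ b.elems)
    (hs : s ∈ 𝒜.truthOf (𝒜.subFalsity a c)) (hs' : s' ∈ 𝒜.truthOf (𝒜.subFalsity c a)) :
    (t, Stack.push s (.push s' π)) ∈ 𝒜.pole :=
  ht _ ((𝒜.mem_nmemFalsity a b _).2 ⟨c, π, s, s', hc, rfl, hs, hs'⟩)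

/-- Removing pairs from the right-hand name only removes stacks from the falsity value, so the term
itself need not change. -/
theorem nmem_of_subset (h : b.elems ⊆ c.elems) (ht : t ∈ 𝒜.truthOf (𝒜.nmemFalsity a c)) :
    t ∈ 𝒜.truthOf (𝒜.nmemFalsity a b) :=
  nmem_intro fun _ _ _ _ hd hs hs' => nmem_elim ht (h hd) hs hs'

theorem sub_of_subset_left (h : a.elems ⊆ b.elems) (ht : t ∈ 𝒜.truthOf (𝒜.subFalsity b c)) :
    t ∈ 𝒜.truthOf (𝒜.subFalsity a c) :=
  sub_intro fun _ _ _ hd hs => sub_elim ht (h hd) hs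

theorem sub_of_subset_right (h : b.elems ⊆ c.elems) (ht : t ∈ 𝒜.truthOf (𝒜.subFalsity a b)) :
    t ∈ 𝒜.truthOf (𝒜.subFalsity a c) :=
  sub_intro fun _ _ _ hd hs => sub_elim ht hd (nmem_of_subset h hs)

end Relations

end RealizabilityAlgebra

/-! ## Hereditarily transitive names -/

/-- A name is hereditarily transitive if it includes each name in its domain, as sets of pairs,
and these are hereditarily transitive. -/
inductive Name.HereditarilyTransitive {P : Type u} : Name P → Prop
  | intro (a : Name P) (subset : ∀ c π, (c, π) ∈ a.elems → c.elems ⊆ a.elems)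
      (hereditary : ∀ c π, (c, π) ∈ a.elems → c.HereditarilyTransitive) :
      a.HereditarilyTransitive

section Ordinals

variable {A B : Type u} (ν : Ordinal.{u} → Closed A B) {α β : Ordinal.{u}}

/-- The pairs contributed by γ do not depend on the ordinal in which γ is collected. -/
theorem hat_elems_mono (h : α ≤ β) : (hat ν α).elems ⊆ (hat ν β).elems := by
  intro p hp
  obtain ⟨γ, hγ, π, rfl⟩ := (mem_hat ν α p).1 hp
  exact (mem_hat ν β _).2 ⟨γ, hγ.trans_le h, π, rfl⟩

theorem reish_elems_mono (h : α ≤ β) : (reish A B α).elems ⊆ (reish A B β).elems := by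
  intro p hp
  obtain ⟨γ, hγ, π, rfl⟩ := (mem_reish α p).1 hp
  exact (mem_reish β _).2 ⟨γ, hγ.trans_le h, π, rfl⟩

theorem hat_mem (h : α < β) (π : Stack A B) : (hat ν α, .push (ν α) π) ∈ (hat ν β).elems :=
  (mem_hat ν β _).2 ⟨α, h, π, rfl⟩

theorem reish_mem (h : α < β) (π : Stack A B) : (reish A B α, π) ∈ (reish A B β).elems :=
  (mem_reish β _).2 ⟨α, h, π, rfl⟩

theorem hereditarilyTransitive_hat (α : Ordinal.{u}) : (hat ν α).HereditarilyTransitive := by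
  induction α using WellFoundedLT.induction with
  | _ α ih =>
    refine .intro _ ?_ ?_ <;> intro c π hc <;>
      obtain ⟨γ, hγ, ρ, h⟩ := (mem_hat ν α _).1 hc <;> obtain ⟨rfl, rfl⟩ := Prod.mk.inj h
    · exact hat_elems_mono ν hγ.le
    · exact ih γ hγ

theorem hereditarilyTransitive_reish (α : Ordinal.{u}) :
    (reish A B α).HereditarilyTransitive := by
  induction α using WellFoundedLT.induction with
  | _ α ih =>
    refine .intro _ ?_ ?_ <;> intro c π hc <;>
      obtain ⟨γ, hγ, ρ, h⟩ := (mem_reish α _).1 hc <;> obtain ⟨rfl, rfl⟩ := Prod.mk.inj h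
    · exact reish_elems_mono hγ.le
    · exact ih γ hγ

end Ordinals

/-! ## Injectivity of ordered pairs -/

section Pairing

variable {A B : Type u} [Nonempty B] {a b c d : Name (Stack A B)}

theorem sng_injective : Function.Injective (sng : Name (Stack A B) → Name (Stack A B)) := by
  intro a b h
  -- With no stack bottom there would be no stack, and every singleton name would be empty.
  let π : Stack A B := .bottom (Classical.arbitrary B)
  have h1 : (a, π) ∈ (sng a).elems := Name.mem_ofSet.2 ⟨π, rfl⟩
  rw [h] at h1
  obtain ⟨ρ, hρ⟩ := Name.mem_ofSet.1 h1
  exact (congrArg Prod.fst hρ).symm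

omit [Nonempty B] in
theorem churchZero_ne_churchOne :
    PureTerm.churchZero.toTerm A B ≠ PureTerm.churchOne.toTerm A B := by
  intro h
  simp [PureTerm.churchZero, PureTerm.churchOne, PureTerm.toTerm] at h

/-- The two numerals are syntactically distinct, so the tag on top of a stack tells which component
a pair came from. -/
theorem up_injective (h : up a b = up c d) : a = c ∧ b = d := by
  let π : Stack A B := .bottom (Classical.arbitrary B)
  have h1 : (a, Stack.push (PureTerm.churchZero.toTerm A B) π) ∈ (up a b).elems :=
    Name.mem_ofSet.2 (Or.inl ⟨π, rfl⟩)
  have h2 : (b, Stack.push (PureTerm.churchOne.toTerm A B) π) ∈ (up a b).elems :=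
    Name.mem_ofSet.2 (Or.inr ⟨π, rfl⟩)
  rw [h] at h1 h2
  constructor
  · obtain ⟨ρ, hρ⟩ | ⟨ρ, hρ⟩ := Name.mem_ofSet.1 h1
    · exact (congrArg Prod.fst hρ).symm
    · exact absurd (Stack.push.inj (congrArg Prod.snd hρ)).1.symm churchZero_ne_churchOne
  · obtain ⟨ρ, hρ⟩ | ⟨ρ, hρ⟩ := Name.mem_ofSet.1 h2
    · exact absurd (Stack.push.inj (congrArg Prod.snd hρ)).1 churchZero_ne_churchOne
    · exact (congrArg Prod.fst hρ).symm

theorem op_injective (h : op a b = op c d) : a = c ∧ b = d := by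
  obtain ⟨h1, h2⟩ := up_injective h
  exact ⟨sng_injective (up_injective h1).1, sng_injective (sng_injective h2)⟩

omit [Nonempty B] in
theorem mem_orderedLift {ν : Ordinal.{u} → Closed A B} {f : Ordinal.{u} → Ordinal.{u}}
    {p : Name (Stack A B) × Stack A B} : p ∈ (orderedLift ν f).elems ↔
      ∃ α < kappa A B, ∃ π, p = (op (hat ν α) (hat ν (f α)), .push (ν α) π) := by
  rw [orderedLift, Name.mem_ofSet]
  constructor
  · rintro ⟨⟨⟨β, hβ⟩, π⟩, rfl⟩
    exact ⟨β, hβ, π, rfl⟩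
  · rintro ⟨β, hβ, π, rfl⟩
    exact ⟨⟨⟨β, hβ⟩, π⟩, rfl⟩

end Pairing

/-! ## The realizers -/

namespace PureTerm

variable {n : ℕ}

/-- The variable `0`. -/
abbrev v0 : PureTerm (n + 1) := var 0
/-- The variable `1`. -/
abbrev v1 : PureTerm (n + 2) := var (Fin.succ 0)
/-- The variable `2`. -/
abbrev v2 : PureTerm (n + 3) := var (Fin.succ (Fin.succ 0))
/-- The variable `3`. -/
abbrev v3 : PureTerm (n + 4) := var (Fin.succ (Fin.succ (Fin.succ 0)))
/-- The variable `4`. -/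
abbrev v4 : PureTerm (n + 5) := var (Fin.succ (Fin.succ (Fin.succ (Fin.succ 0))))
/-- The variable `5`. -/
abbrev v5 : PureTerm (n + 6) := var (Fin.succ (Fin.succ (Fin.succ (Fin.succ (Fin.succ 0)))))
/-- The variable `6`. -/
abbrev v6 : PureTerm (n + 7) :=
  var (Fin.succ (Fin.succ (Fin.succ (Fin.succ (Fin.succ (Fin.succ 0))))))
/-- The variable `7`. -/
abbrev v7 : PureTerm (n + 8) :=
  var (Fin.succ (Fin.succ (Fin.succ (Fin.succ (Fin.succ (Fin.succ (Fin.succ 0)))))))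

/-- `λu. λp. λs. p (u u s) (u u p)`. -/
def comparisonStep : PureTerm n :=
  lam (lam (lam (app (app v1 (app (app v2 v2) v0)) (app (app v2 v2) v1))))

/-- A term `c` with `c p s ≻ p (c s) (c p)`. -/
def comparison : PureTerm n := app comparisonStep comparisonStep

/-- `λu. λf. λg. λs. f (λa. λa'. g (λb. λb'. s (u u a b) (u u b' a')))`. -/
def subTransStep : PureTerm n :=
  lam (lam (lam (lam (app v2 (lam (lam (app v3 (lam (lam
    (app (app v4 (app (app (app v7 v7) v3) v1))
      (app (app (app v7 v7) v0) v2)))))))))))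

/-- A fixed point realizing the transitivity of `⊆`. -/
def subTrans : PureTerm n := app subTransStep subTransStep

/-- Realizes `w ∈ succ x → w ∈ x ∨ w ≃ x`. -/
def memSuccElim : PureTerm n :=
  lam (lam (lam (app v1 (lam (app v3 (lam (lam (app v3 (lam (app (app v0 v2)
    (app (app subTrans (app comparison (lam (lam
      (app (app v5 (app (app subTrans v4) v1)) (app (app subTrans v0) v3)))))) v1)))))))))))

/-- Realizes `w ∈ x ∨ w ≃ x → w ∈ succ x`, where the variable `1` stands for the term
attached to `x`. -/
def memSuccIntro : PureTerm (n + 2) :=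
  lam (lam (app (app v1 (lam (app v0 v1)))
    (lam (app v0 (lam (lam (app (app (app v3 v1) v0) v6)))))))

/-- Realizes `∀ x^κ̂ (succ x ≃ x + 1)`. -/
def isSuccRealizer : PureTerm n := lam (lam (app (app v0 memSuccElim) memSuccIntro))

/-- Realizes `∀ x^κ̂ ∀ y (op(x, y) ε succ → y ≃ x + 1)`. -/
def liftRealizer : PureTerm n :=
  lam (lam (app cc (lam (app v1 (lam (app v1 (app isSuccRealizer v0)))))))

/-- `λu. λs. s (u u) (c s)`, where `c` is `comparison`. -/
def hatSubReishStep : PureTerm n :=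
  lam (lam (app (app v0 (app v1 v1)) (app comparison v0)))

/-- Realizes the inclusion of the hat name of an ordinal in its recursive name. -/
def hatSubReish : PureTerm n := app hatSubReishStep hatSubReishStep

/-- Transforms a realizer of the inclusion of the recursive name of `m` in its hat name into
a function that sends `ν_m, …, ν_{m+j-1}` to a realizer of the equality of the names of `m + j`. -/
def reishSimeqHatFrom {n : ℕ} : ℕ → PureTerm n
  | 0 => lam (lam (app (app v0 v1) hatSubReish))
  | j + 1 => lam (lam (app (reishSimeqHatFrom j)
      (lam (app (app (app v0 v2) (app comparison v0)) v1))))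

end PureTerm

/-- The stack `ν_m · … · ν_{m+j-1} · π`. -/
def pushInitial {A B : Type u} (ν : Ordinal.{u} → Closed A B) (π : Stack A B) :
    ℕ → ℕ → Stack A B
  | _, 0 => π
  | m, j + 1 => .push (ν m) (pushInitial ν π (m + 1) j)

/-- Iterated application exposes its last argument first, whereas the recursion on stacks starts
from the first one; this reconciles the two orders. -/
theorem pushInitial_push {A B : Type u} (ν : Ordinal.{u} → Closed A B) (π : Stack A B)
    (m j : ℕ) : pushInitial ν (.push (ν (m + j : ℕ)) π) m j = pushInitial ν π m (j + 1) := by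
  induction j generalizing m with
  | zero => rfl
  | succ j ih =>
    rw [pushInitial, pushInitial, ← ih (m + 1), Nat.add_right_comm m 1 j]
    rfl

theorem isRealizer_appInitial {A B : Type u} {ν : Ordinal.{u} → Closed A B} {t : Closed A B}
    (ht : t.IsRealizer) {n : ℕ} (h : ∀ i < n, (ν (i : ℕ)).IsRealizer) :
    (appInitial ν t n).IsRealizer := by
  induction n with
  | zero => exact ht
  | succ n ih =>
    rw [appInitial, Term.IsRealizer]
    exact ⟨ih fun i hi => h i (hi.trans n.lt_succ_self), h n n.lt_succ_self⟩

-- Correctness of the realizers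

namespace RealizabilityAlgebra

variable {A B : Type u} {𝒜 : RealizabilityAlgebra A B} {n : ℕ} (σ : Fin n → Closed A B)

open PureTerm

theorem w₀_sub (a : Name (Stack A B)) : w₀.close σ ∈ 𝒜.truthOf (𝒜.subFalsity a a) := by
  induction a using Name.wellFounded_inDom.induction with
  | _ a ih =>
    refine sub_intro fun c π s hc hs => ?_
    refine pole_close_app (pole_close_lam (pole_close_lam
      (pole_close_app (pole_close_app (pole_close_var ?_)))))
    exact nmem_elim hs hc (ih c ⟨π, hc⟩) (ih c ⟨π, hc⟩)

/-- The term satisfies c p s ≻ p (c s) (c p). For d in the domain of b and s realizing d ∉ a, the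
call c s yields a ⊆ d with the roles exchanged, while c p yields d ⊆ a, because d is included in b
and so p also realizes a ∉ d. One call swaps the two sides, hence the induction on unordered pairs.
-/
theorem comparison_sub {a b : Name (Stack A B)} (ha : a.HereditarilyTransitive)
    (hb : b.HereditarilyTransitive) {p : Closed A B}
    (hp : p ∈ 𝒜.truthOf (𝒜.nmemFalsity a b)) :
    (comparison.close σ).app p ∈ 𝒜.truthOf (𝒜.subFalsity b a) := by
  induction a, b using Sym2.GameAdd.recursion Name.wellFounded_inDom generalizing p with
  | IH a b ih =>
    refine sub_intro fun d π s hd hs => ?_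
    obtain ⟨_, hsub, hher⟩ := hb
    refine pole_app (pole_close_app (pole_close_lam (pole_close_lam (pole_close_lam
      (pole_close_app (pole_close_app (pole_close_var ?_)))))))
    have hdb : d.InDom b := ⟨π, hd⟩
    exact nmem_elim hp hd
      (ih d a (Sym2.GameAdd.fst_snd hdb) (hher d π hd) ha hs)
      (ih a d (Sym2.GameAdd.snd hdb) ha (hher d π hd) (nmem_of_subset (hsub d π hd) hp))

/-- The recursive calls prove x ⊆ z and z ⊆ x, reversing the outer names, but both pass through a y
in the domain of b. The induction is therefore on the middle name, with the outer two arbitrary. -/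
theorem subTrans_sub {a b c : Name (Stack A B)} {f g : Closed A B}
    (hf : f ∈ 𝒜.truthOf (𝒜.subFalsity a b)) (hg : g ∈ 𝒜.truthOf (𝒜.subFalsity b c)) :
    ((subTrans.close σ).app f).app g ∈ 𝒜.truthOf (𝒜.subFalsity a c) := by
  induction b using Name.wellFounded_inDom.induction generalizing a c f g with
  | _ b ih =>
    refine sub_intro fun x π s hx hs => ?_
    refine pole_app (pole_app (pole_close_app (pole_close_lam (pole_close_lam (pole_close_lam
      (pole_close_lam (pole_close_app (pole_close_var ?_))))))))
    refine sub_elim hf hx (nmem_intro fun y ρ u u' hy hu hu' => ?_)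
    refine pole_close_lam (pole_close_lam (pole_close_app (pole_close_var ?_)))
    refine sub_elim hg hy (nmem_intro fun z τ v v' hz hv hv' => ?_)
    refine pole_close_lam (pole_close_lam (pole_close_app (pole_close_app (pole_close_var ?_))))
    exact nmem_elim hs hz (ih y ⟨ρ, hy⟩ hu hv) (ih y ⟨ρ, hy⟩ hv' hu')

theorem hat_sub_hat (ν : Ordinal.{u} → Closed A B) {α β : Ordinal.{u}} (h : α ≤ β)
    {t : Closed A B} (ht : ∀ γ < α, ∀ s π, (s, Stack.push (w₀.close σ) (.push (w₀.close σ)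
      (.push (ν γ) π))) ∈ 𝒜.pole → (t, Stack.push s (.push (ν γ) π)) ∈ 𝒜.pole) :
    t ∈ 𝒜.truthOf (𝒜.subFalsity (hat ν α) (hat ν β)) := by
  refine sub_intro fun c ρ s hc hs => ?_
  obtain ⟨γ, hγ, π, hp⟩ := (mem_hat ν α _).1 hc
  obtain ⟨rfl, rfl⟩ := Prod.mk.inj hp
  exact ht γ hγ s π
    (nmem_elim hs (hat_mem ν (hγ.trans_le h) π) (w₀_sub σ _) (w₀_sub σ _))

theorem realizes_w₀ : 𝒜.Realizes (w₀.toTerm A B) (.all fun x => .sub x x) := by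
  rintro π ⟨a, hπ⟩
  rw [toTerm_eq_close _ Fin.elim0]
  exact w₀_sub _ a π hπ

theorem realizes_succRealizer (ν : Ordinal.{u} → Closed A B) :
    𝒜.Realizes (succRealizer.toTerm A B) (.hatAllLift ν Order.succ fun x sx =>
      .all fun y => .imp (.imp (.sub y x) .bot) (.nmemEps y sx)) := by
  rintro _ ⟨β, -, _, rfl, y, t, ρ, rfl, ht, hρ⟩
  obtain ⟨γ, hγ, π, hp⟩ := (mem_hat ν _ _).1 hρ
  obtain ⟨rfl, rfl⟩ := Prod.mk.inj hp
  rw [toTerm_eq_close _ Fin.elim0]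
  refine pole_close_lam (pole_close_lam (pole_close_app (pole_close_var ?_)))
  refine ht _ ⟨_, _, rfl, ?_, trivial⟩
  refine hat_sub_hat Fin.elim0 ν (Order.lt_succ_iff.1 hγ) fun δ _ s π h => ?_
  refine pole_close_lam (pole_close_app (pole_close_app (pole_close_var ?_)))
  exact h

theorem memSuccElim_realizes (ν : Ordinal.{u} → Closed A B) (β : Ordinal.{u})
    (w : Name (Stack A B)) : 𝒜.Realizes (memSuccElim.close σ)
      (.imp (.mem w (hat ν (Order.succ β)))
        (.or (.mem w (hat ν β)) (.simeq w (hat ν β)))) := by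
  rintro _ ⟨h, _, rfl, hh, p, _, rfl, hp, q, ρ, rfl, hq, -⟩
  refine pole_close_lam (pole_close_lam (pole_close_lam (pole_close_app (pole_close_var ?_))))
  refine hp _ ⟨_, _, rfl, ?_, trivial⟩
  rintro _ ⟨k, π, rfl, hk, -⟩
  refine pole_close_lam (pole_close_app (pole_close_var ?_))
  refine hh _ ⟨_, _, rfl, ?_, trivial⟩
  refine nmem_intro fun c τ a a' hc ha ha' => ?_
  obtain ⟨γ, hγ, υ, h⟩ := (mem_hat ν _ _).1 hc
  obtain ⟨rfl, rfl⟩ := Prod.mk.inj h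
  refine pole_close_lam (pole_close_lam (pole_close_app (pole_close_var ?_)))
  refine hq _ ⟨_, _, rfl, ?_, trivial⟩
  rintro _ ⟨m, χ, rfl, hm, -⟩
  refine pole_close_lam (pole_close_app (pole_close_app (pole_close_var ?_)))
  -- As γ ≤ β, the realizer of w ⊆ γ̂ serves for w ⊆ β̂. The cases γ < β and γ = β are never
  -- separated.
  refine hm _ ⟨_, _, rfl,
    sub_of_subset_right (hat_elems_mono ν (Order.lt_succ_iff.1 hγ)) ha, _, _, rfl, ?_, trivial⟩
  refine subTrans_sub _ (comparison_sub _ (hereditarilyTransitive_hat ν γ)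
    (hereditarilyTransitive_hat ν β) ?_) ha'
  -- It remains to realize γ̂ ∉ β̂: this is w ∉ β̂ transported along w ≃ γ̂.
  refine nmem_intro fun d ψ c c' hd hc hc' => ?_
  refine pole_close_lam (pole_close_lam (pole_close_app (pole_close_app (pole_close_var ?_))))
  exact nmem_elim hk hd (subTrans_sub _ ha hc) (subTrans_sub _ hc' ha')

theorem memSuccIntro_realizes (ν : Ordinal.{u} → Closed A B) (β : Ordinal.{u})
    (w : Name (Stack A B)) (k : Closed A B) :
    𝒜.Realizes (memSuccIntro.close (Fin.cons k (Fin.cons (ν β) σ)))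
      (.imp (.or (.mem w (hat ν β)) (.simeq w (hat ν β))) (.mem w (hat ν (Order.succ β)))) := by
  rintro _ ⟨v, _, rfl, hv, j, ρ, rfl, hj, -⟩
  refine pole_close_lam (pole_close_lam (pole_close_app (pole_close_app (pole_close_var ?_))))
  refine hv _ ⟨_, _, rfl, ?_, _, _, rfl, ?_, trivial⟩
  · rintro _ ⟨m, π, rfl, hm, -⟩
    refine pole_close_lam (pole_close_app (pole_close_var ?_))
    exact hm _ ⟨_, _, rfl, nmem_of_subset (hat_elems_mono ν (Order.le_succ β)) hj, trivial⟩
  · rintro _ ⟨e, π, rfl, he, -⟩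
    refine pole_close_lam (pole_close_app (pole_close_var ?_))
    refine he _ ⟨_, _, rfl, ?_, trivial⟩
    rintro _ ⟨a, _, rfl, ha, a', τ, rfl, ha', -⟩
    refine pole_close_lam (pole_close_lam
      (pole_close_app (pole_close_app (pole_close_app (pole_close_var ?_)))))
    -- The element β̂ of the successor name carries the stack ν_β · τ, so the term must push ν_β
    -- itself.
    exact nmem_elim hj (hat_mem ν (Order.lt_succ β) τ) ha ha'

theorem isSuccRealizer_pole (ν : Ordinal.{u} → Closed A B) (β : Ordinal.{u}) {π : Stack A B}
    (hπ : π ∈ 𝒜.falsity (.isSucc (hat ν (Order.succ β)) (hat ν β))) :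
    (isSuccRealizer.close σ, Stack.push (ν β) π) ∈ 𝒜.pole := by
  obtain ⟨w, k, ρ, rfl, hk, -⟩ := hπ
  refine pole_close_lam (pole_close_lam (pole_close_app (pole_close_app (pole_close_var ?_))))
  exact hk _ ⟨_, _, rfl, memSuccElim_realizes _ ν β w, _, _, rfl,
    memSuccIntro_realizes _ ν β w k, trivial⟩

theorem liftRealizer_realizes [Nonempty B] (ν : Ordinal.{u} → Closed A B) :
    𝒜.Realizes (liftRealizer.close σ) (.hatAll ν (kappa A B) fun x => .all fun y =>
      .imp (.memEps (op x y) (orderedLift ν Order.succ)) (.isSucc y x)) := by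
  rintro _ ⟨β, -, _, rfl, y, e, π, rfl, he, hπ⟩
  refine pole_close_lam (pole_close_lam (pole_close_app (pole_close_cc
    (pole_close_lam (pole_close_app (pole_close_var ?_))))))
  refine he _ ⟨_, _, rfl, fun ρ hρ => ?_, trivial⟩
  obtain ⟨α, -, τ, h⟩ := mem_orderedLift.1 hρ
  obtain ⟨hop, rfl⟩ := Prod.mk.inj h
  -- This is equality of names as sets, not only realized equality, so the goal can be rewritten to
  -- α. The code ν_α found on the stack of the lift is used in place of the given ν_β, and the saved
  -- continuation restores π.
  obtain ⟨hβ, rfl⟩ := op_injective hop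
  rw [hβ] at hπ
  exact pole_close_lam (pole_close_app (pole_close_var (pole_cont
    (pole_close_app (isSuccRealizer_pole _ ν α hπ)))))

/-- The term satisfies h s ≻ s h (c s). At β < α, h gives β̂ ⊆ ג_β by induction, and comparison
turns s, a realizer of β̂ ∉ ג_α, into one of ג_α ⊆ β̂, hence of ג_β ⊆ β̂. -/
theorem hatSubReish_sub (ν : Ordinal.{u} → Closed A B) (α : Ordinal.{u}) :
    hatSubReish.close σ ∈ 𝒜.truthOf (𝒜.subFalsity (hat ν α) (reish A B α)) := by
  induction α using WellFoundedLT.induction with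
  | _ α ih =>
    refine sub_intro fun c ρ s hc hs => ?_
    obtain ⟨β, hβ, π, h⟩ := (mem_hat ν _ _).1 hc
    obtain ⟨rfl, rfl⟩ := Prod.mk.inj h
    refine pole_close_app (pole_close_lam (pole_close_lam
      (pole_close_app (pole_close_app (pole_close_var ?_)))))
    -- The stack here is ν_β · π; it is admissible because the recursive name pairs ג_β with every
    -- stack.
    exact nmem_elim hs (reish_mem hβ _) (ih β hβ) (sub_of_subset_left (reish_elems_mono hβ.le)
      (comparison_sub _ (hereditarilyTransitive_hat ν β) (hereditarilyTransitive_reish α) hs))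

/-- Carrying f as an accumulator lets the codes be consumed in the order ν_m, ν_{m+1}, … in which
they lie on the stack. -/
theorem reishSimeqHatFrom_pole (ν : Ordinal.{u} → Closed A B) (m j : ℕ) {f : Closed A B}
    (hf : f ∈ 𝒜.truthOf (𝒜.subFalsity (reish A B m) (hat ν m))) {π : Stack A B}
    (hπ : π ∈ 𝒜.falsity (.simeq (reish A B (m + j : ℕ)) (hat ν (m + j : ℕ)))) :
    ((reishSimeqHatFrom j).close σ, Stack.push f (pushInitial ν π m j)) ∈ 𝒜.pole := by
  induction j generalizing n m f with
  | zero =>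
    obtain ⟨k, ρ, rfl, hk, -⟩ := hπ
    refine pole_close_lam (pole_close_lam (pole_close_app (pole_close_app (pole_close_var ?_))))
    exact hk _ ⟨_, _, rfl, hf, _, _, rfl, hatSubReish_sub _ ν m, trivial⟩
  | succ j ih =>
    refine pole_close_lam (pole_close_lam (pole_close_app ?_))
    rw [← Nat.add_assoc, Nat.add_right_comm] at hπ
    refine ih _ (m + 1) (sub_intro fun c ρ s hc hs => ?_) hπ
    rw [Nat.cast_succ] at hc hs
    obtain ⟨α, hα, τ, h⟩ := (mem_reish _ _).1 hc
    obtain ⟨rfl, rfl⟩ := Prod.mk.inj h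
    replace hα : α ≤ m := Order.lt_succ_iff.1 hα
    have hm : (m : Ordinal.{u}) < m + 1 := Order.lt_succ _
    refine pole_close_lam
      (pole_close_app (pole_close_app (pole_close_app (pole_close_var ?_))))
    -- Every α ≤ m is compared with the top element m̂, even when α < m: f gives ג_α ⊆ m̂, and
    -- comparison applied to s gives m̂ ⊆ ג_α. Thus ν_m is the only new code required.
    exact nmem_elim hs (hat_mem ν hm ρ) (sub_of_subset_left (reish_elems_mono hα) hf)
      (comparison_sub _ (hereditarilyTransitive_reish α) (hereditarilyTransitive_hat ν m)
        (nmem_of_subset (hat_elems_mono ν hm.le) hs))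

theorem pole_appInitial (ν : Ordinal.{u} → Closed A B) {t : Closed A B} {π : Stack A B} {j : ℕ}
    (h : (t, pushInitial ν π 0 j) ∈ 𝒜.pole) : (appInitial ν t j, π) ∈ 𝒜.pole := by
  induction j generalizing π with
  | zero => exact h
  | succ j ih =>
    rw [← pushInitial_push, Nat.zero_add] at h
    exact pole_app (ih h)

theorem appInitial_realizes (ν : Ordinal.{u} → Closed A B) (j : ℕ) :
    𝒜.Realizes (appInitial ν (((reishSimeqHatFrom j).app w₀).toTerm A B) j)
      (.simeq (reish A B j) (hat ν j)) := by
  intro π hπ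
  rw [toTerm_eq_close _ Fin.elim0]
  rw [← Nat.zero_add j] at hπ
  refine pole_appInitial ν (pole_close_app (reishSimeqHatFrom_pole _ ν 0 j ?_ hπ))
  -- The recursive name of 0 has no elements, so any term realizes this inclusion; `w₀` is an
  -- arbitrary choice of starting accumulator.
  refine sub_intro fun c ρ s hc _ => ?_
  obtain ⟨α, hα, -⟩ := (mem_reish _ _).1 hc
  simp at hα

end RealizabilityAlgebra

end Realizability

open Realizability in
theorem mainTheorem11 :
    ∃ (t s : PureTerm 0) (r : ℕ → PureTerm 0),
      ∀ (A B : Type u) [Nonempty B] (𝒜 : RealizabilityAlgebra A B)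
        (ν : Ordinal.{u} → Closed A B), Set.SurjOn ν (Set.Iio (kappa A B)) Set.univ →
        𝒜.Realizes (PureTerm.w₀.toTerm A B) (.all fun x => .sub x x) ∧
        𝒜.Realizes (PureTerm.succRealizer.toTerm A B)
          (.hatAllLift ν Order.succ fun x sx =>
            .all fun y => .imp (.imp (.sub y x) .bot) (.nmemEps y sx)) ∧
        𝒜.Realizes (t.toTerm A B)
          (.hatAllLift ν Order.succ fun x sx => .isSucc sx x) ∧
        𝒜.Realizes (s.toTerm A B)
          (.hatAll ν (kappa A B) fun x => .all fun y =>
            .imp (.memEps (op x y) (orderedLift ν Order.succ)) (.isSucc y x)) ∧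
        (∀ α < kappa A B,
          𝒜.Realizes (.app (t.toTerm A B) (ν α)) (.isSucc (hat ν (Order.succ α)) (hat ν α)) ∧
          ((ν α).IsRealizer → 𝒜.Models (.isSucc (hat ν (Order.succ α)) (hat ν α)))) ∧
        (∀ n : ℕ,
          𝒜.Realizes (appInitial ν ((r n).toTerm A B) n) (.simeq (reish A B n) (hat ν n)) ∧
          ((∀ i < n, (ν i).IsRealizer) → 𝒜.Models (.simeq (reish A B n) (hat ν n)))) := by
  refine ⟨PureTerm.isSuccRealizer, PureTerm.liftRealizer,
    fun n => (PureTerm.reishSimeqHatFrom n).app PureTerm.w₀, fun A B _ 𝒜 ν _ => ?_⟩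
  have ht : ∀ α, 𝒜.Realizes (.app (PureTerm.isSuccRealizer.toTerm A B) (ν α))
      (.isSucc (hat ν (Order.succ α)) (hat ν α)) := by
    intro α π hπ
    rw [PureTerm.toTerm_eq_close _ Fin.elim0]
    exact RealizabilityAlgebra.pole_app (RealizabilityAlgebra.isSuccRealizer_pole _ ν α hπ)
  have hr : ∀ {α}, (ν α).IsRealizer →
      (Term.app (PureTerm.isSuccRealizer.toTerm A B) (ν α)).IsRealizer := by
    intro α hα
    rw [Term.IsRealizer]
    exact ⟨PureTerm.isRealizer_toTerm A B _, hα⟩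
  refine ⟨RealizabilityAlgebra.realizes_w₀, RealizabilityAlgebra.realizes_succRealizer ν,
    ?_, ?_, fun α _ => ⟨ht α, fun hα => ⟨_, hr hα, ht α⟩⟩,
    fun n => ⟨RealizabilityAlgebra.appInitial_realizes ν n, fun h => ⟨_,
      isRealizer_appInitial (PureTerm.isRealizer_toTerm A B _) h,
      RealizabilityAlgebra.appInitial_realizes ν n⟩⟩⟩
  · rintro _ ⟨β, -, π, rfl, hπ⟩
    rw [PureTerm.toTerm_eq_close _ Fin.elim0]
    exact RealizabilityAlgebra.isSuccRealizer_pole _ ν β hπ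
  · rw [PureTerm.toTerm_eq_close _ Fin.elim0]
    exact RealizabilityAlgebra.liftRealizer_realizes _ ν
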